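/- **Conventions.** $B_n$ is the braid group on $n\ge 1$ strands with its standard generators, $\sigma_i$ being a positive crossing, $\widehat\beta$ is the oriented link obtained by closing $\beta\in B_n$, and $w=w(\beta)$ is the exponent sum (writhe) of $\beta$. The Homflypt polynomial $P_L(v,z)\in\mathbb Z[v^{\pm1},z^{\pm1}]$ is the invariant of oriented links with value $1$ on the trivial knot and with $P_{D_+}=vz\,P_{D_0}+v^2P_{D_-}$; the Conway polynomial is $\nabla_L(z)=P_L(1,z)$. For $p\in\mathbb Z$ let $C_p=C_p(z)=\nabla_{\widehat{\sigma_1^{\,p}}}(z)$, $\sigma_1\in B_2$, be the Conway polynomial of the elementary torus link with $p$ half twists on two strands. **Theorem.** Let $n\ge 1$. 1. For every $\beta\in B_n$ with writhe $w$, the Homflypt polynomial has the form $$P_{\widehat\beta}(v,z)=v^{\,w-n+1}\sum_{j=0}^{n-1}h_j(z)\,v^{2j},\qquad h_j\in\mathbb Z[z,z^{-1}],$$ and the Laurent coefficient polynomials $h_j$ satisfy $$\sum_{j=0}^{n-1}C_{2j-3}\,h_j=C_{4+w-n}\quad(\mathrm{I}),\qquad \sum_{j=0}^{n-1}C_{2j-1}\,h_j=C_{2+w-n}\quad(\mathrm{II}).$$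 2. If $n>1$, these relations are independent: for every integer $w$ there are $f_0,\dots,f_{n-1}\in\mathbb Z[z]$ that satisfy (I) but not (II) (with $f_j$ in place of $h_j$), and there are $f_0,\dots,f_{n-1}\in\mathbb Z[z]$ that satisfy (II) but not (I). 3. Let $w$ be any integer and let $f_0,\dots,f_{n-1}$ be elements of any commutative $\mathbb Z[z,z^{-1}]$-algebra (for instance Laurent polynomials, or functions of $z\neq0$ with values in a field) that satisfy both (I) and (II). Then for every integer $\kappa$ $$\sum_{j=0}^{n-1}C_{2j-1-\kappa}\,f_j=(-1)^{\kappa}\,C_{\kappa+2+w-n}.$$ -/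

import Mathlib

open scoped LaurentPolynomial

noncomputable section

namespace HomflyBraid

/-! ### Braid groups -/

/-- Artin's relations on the generators of the braid group on `n` strands. -/
inductive ArtinRel (n : ℕ) : FreeGroup (Fin (n - 1)) → Prop
  | comm (i j : Fin (n - 1)) (h : (i : ℕ) + 1 < j) :
      ArtinRel n (FreeGroup.of i * FreeGroup.of j * (FreeGroup.of j * FreeGroup.of i)⁻¹)
  | braid (i j : Fin (n - 1)) (h : (i : ℕ) + 1 = j) :
      ArtinRel n (FreeGroup.of i * FreeGroup.of j * FreeGroup.of i *
        (FreeGroup.of j * FreeGroup.of i * FreeGroup.of j)⁻¹)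

/-- The braid group on `n` strands, in Artin's presentation. -/
abbrev BraidGroup (n : ℕ) : Type := PresentedGroup {r | ArtinRel n r}

/-- The standard generators; `σ i` (with `i` counted from `0`) is the positive crossing of the
adjacent strands number `i` and `i + 1`. -/
def σ {n : ℕ} (i : ℕ) (h : i + 1 < n) : BraidGroup n :=
  PresentedGroup.of ⟨i, by omega⟩

/-- Two homomorphisms out of a braid group agree if they agree on the generators. -/
theorem hom_ext {n : ℕ} {G : Type*} [Group G] {φ ψ : BraidGroup n →* G}
    (H : ∀ i h, φ (σ i h) = ψ (σ i h)) : φ = ψ :=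
  PresentedGroup.ext fun x => H x (by omega)

theorem induction_gen {n : ℕ} {p : BraidGroup n → Prop} (h1 : p 1)
    (hs : ∀ i h g, p g → p (g * σ i h)) (hi : ∀ i h g, p g → p (g * (σ i h)⁻¹))
    (g : BraidGroup n) : p g := by
  have hg : g ∈ Subgroup.closure (Set.range (PresentedGroup.of (rels := {r | ArtinRel n r}))) := by
    rw [PresentedGroup.closure_range_of]; trivial
  induction hg using Subgroup.closure_induction_right with
  | one => exact h1
  | mul_right x hx y hy ih => obtain ⟨i, rfl⟩ := hy; exact hs i (by omega) x ih
  | mul_inv_cancel x hx y hy ih => obtain ⟨i, rfl⟩ := hy; exact hi i (by omega) x ih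

/-- The universal property of the braid group. -/
def liftGen {n : ℕ} {G : Type*} [Group G] (f : ℕ → G)
    (hc : ∀ i j, i + 1 < j → j + 1 < n → f i * f j = f j * f i)
    (hb : ∀ i, i + 2 < n → f i * f (i + 1) * f i = f (i + 1) * f i * f (i + 1)) :
    BraidGroup n →* G :=
  PresentedGroup.toGroup (f := fun i : Fin (n - 1) => f i) (by
    intro r hr
    cases hr with
    | comm i j h => simp [hc i j h (by omega)]
    | braid i j h => simp [← h, hb i (by omega)])

@[simp] theorem liftGen_σ {n : ℕ} {G : Type*} [Group G] (f : ℕ → G) (hc) (hb) (i : ℕ) (h) :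
    liftGen (n := n) f hc hb (σ i h) = f i := by
  simp [liftGen, σ]

theorem σ_comm {n : ℕ} (i j : ℕ) (h : i + 1 < j) (hj : j + 1 < n) :
    σ (n := n) i (by omega) * σ j hj = σ j hj * σ i (by omega) :=
  PresentedGroup.mk_eq_mk_of_mul_inv_mem (ArtinRel.comm ⟨i, by omega⟩ ⟨j, by omega⟩ h)

theorem σ_braid {n : ℕ} (i : ℕ) (h : i + 2 < n) :
    σ (n := n) i (by omega) * σ (i + 1) (by omega) * σ i (by omega) =
      σ (i + 1) (by omega) * σ i (by omega) * σ (i + 1) (by omega) :=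
  PresentedGroup.mk_eq_mk_of_mul_inv_mem
    (ArtinRel.braid ⟨i, by omega⟩ ⟨i + 1, by omega⟩ rfl)

/-- The exponent sum, as a homomorphism. -/
def writheHom (n : ℕ) : BraidGroup n →* Multiplicative ℤ :=
  liftGen (fun _ => Multiplicative.ofAdd 1) (fun _ _ _ _ => rfl) (fun _ _ => rfl)

/-- The writhe of a braid: the sum of the exponents of any word in the generators for it. -/
def writhe {n : ℕ} (β : BraidGroup n) : ℤ := (writheHom n β).toAdd

/-- The inclusion of the braid group on `n` strands into that on `n + 1` strands, which adds a
straight strand at the end. -/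
def incl {n : ℕ} : BraidGroup n →* BraidGroup (n + 1) :=
  PresentedGroup.toGroup (f := fun i : Fin (n - 1) => σ (n := n + 1) i (by omega)) (by
    intro r hr
    cases hr with
    | comm i j h => simp [σ_comm (n := n + 1) i j h (by omega)]
    | braid i j h => simp [← h, σ_braid (n := n + 1) i (by omega)])

@[simp] theorem incl_σ {n : ℕ} (i : ℕ) (h : i + 1 < n) :
    incl (σ i h) = σ (n := n + 1) i (by omega) := by
  simp [incl, σ]

/-! ### Links as closed braids -/

/-- A braid on at least one strand, of which the closure is to be taken. -/
structure ClosedBraid : Type where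
  strands : ℕ
  pos : 0 < strands
  braid : BraidGroup strands

/-- The Markov moves: conjugation, positive stabilization and negative stabilization. -/
inductive MarkovMove : ClosedBraid → ClosedBraid → Prop
  | conj (n : ℕ) (hn : 0 < n) (α β : BraidGroup n) : MarkovMove ⟨n, hn, α * β⟩ ⟨n, hn, β * α⟩
  | stabPos (n : ℕ) (hn : 0 < n) (β : BraidGroup n) :
      MarkovMove ⟨n, hn, β⟩ ⟨n + 1, n.succ_pos, incl β * σ (n - 1) (by omega)⟩
  | stabNeg (n : ℕ) (hn : 0 < n) (β : BraidGroup n) :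
      MarkovMove ⟨n, hn, β⟩ ⟨n + 1, n.succ_pos, incl β * (σ (n - 1) (by omega))⁻¹⟩

/-- Oriented links up to isotopy. Every (nonempty) oriented link is the closure of a braid, and two
braids have isotopic closures exactly if they are related by a sequence of Markov moves and their
inverses (the theorems of Alexander and Markov). -/
def OrientedLink : Type := Quot MarkovMove

/-- The link that is the standard closure of a braid. -/
def braidClosure {n : ℕ} (hn : 0 < n) (β : BraidGroup n) : OrientedLink :=
  Quot.mk MarkovMove ⟨n, hn, β⟩

/-! ### The Homflypt polynomial -/

/-- The ring of Laurent polynomials with integer coefficients in the two variables `v`, `z`.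
The coefficient ring `ℤ[T;T⁻¹]` has the variable `z`, and the outer variable is `v`. -/
abbrev LaurentVZ : Type := ℤ[T;T⁻¹][T;T⁻¹]

/-- The variable `v`. -/
def varV : LaurentVZ := LaurentPolynomial.T 1

/-- The variable `z`. -/
def varZ : LaurentVZ := LaurentPolynomial.C (LaurentPolynomial.T 1)

/-- `P` is an invariant of oriented links with value `1` on the trivial knot that satisfies
the skein relation `P(D₊) = v z P(D₀) + v² P(D₋)`. -/
structure IsHomflypt (P : OrientedLink → LaurentVZ) : Prop where
  unknot : P (braidClosure one_pos (1 : BraidGroup 1)) = 1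
  skein : ∀ (n : ℕ) (hn : 0 < n) (α β : BraidGroup n) (i : ℕ) (hi : i + 1 < n),
    P (braidClosure hn (α * σ i hi * β)) =
      varV * varZ * P (braidClosure hn (α * β)) + varV ^ 2 * P (braidClosure hn (α * (σ i hi)⁻¹ * β))

/-! ### Existence and uniqueness of the Homflypt polynomial -/

section Skein

variable {R : Type} [CommRing R]

/-- The functions on the braid group that factor through the Hecke algebra. -/
def IsSkein {n : ℕ} (z : R) (φ : BraidGroup n → R) : Prop :=
  ∀ α β i h, φ (α * σ i h * β) = z * φ (α * β) + φ (α * (σ i h)⁻¹ * β)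

theorem IsSkein.comp_mul {n : ℕ} {z : R} {φ : BraidGroup n → R} (hφ : IsSkein z φ)
    (a b : BraidGroup n) : IsSkein z fun x => φ (a * x * b) := by
  intro α β i h
  have := hφ (a * α) (β * b) i h
  simpa only [mul_assoc] using this

theorem IsSkein.comp_incl {n : ℕ} {z : R} {φ : BraidGroup (n + 1) → R} (hφ : IsSkein z φ) :
    IsSkein z fun x : BraidGroup n => φ (incl x) := by
  intro α β i h
  simpa using hφ (incl α) (incl β) i (by omega)

theorem IsSkein.sub {n : ℕ} {z : R} {φ ψ : BraidGroup n → R} (hφ : IsSkein z φ)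
    (hψ : IsSkein z ψ) : IsSkein z fun x => φ x - ψ x := by
  intro α β i h
  simp only [hφ α β i h, hψ α β i h]; ring

theorem incl_comm_σ {m : ℕ} (b : BraidGroup (m + 1)) :
    incl (incl b) * σ (m + 1) (by omega) = σ (n := m + 3) (m + 1) (by omega) * incl (incl b) := by
  have : (MulAut.conj (σ (n := m + 3) (m + 1) (by omega))⁻¹).toMonoidHom.comp (incl.comp incl) =
      (incl.comp incl : BraidGroup (m + 1) →* BraidGroup (m + 3)) := by
    apply hom_ext
    intro i h
    have := σ_comm (n := m + 3) i (m + 1) (by omega) (by omega)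
    simp [mul_assoc, this]
  have h2 := DFunLike.congr_fun this b
  simp only [MonoidHom.comp_apply, MulEquiv.coe_toMonoidHom, MulAut.conj_apply, inv_inv] at h2
  have h3 := congrArg (σ (n := m + 3) (m + 1) (by omega) * ·) h2
  simpa [mul_assoc] using h3

theorem mul_σ_σ {n : ℕ} {z : R} {φ : BraidGroup n → R} (hφ : IsSkein z φ) (x y : BraidGroup n)
    (i h) : φ (x * σ i h * σ i h * y) = z * φ (x * σ i h * y) + φ (x * y) := by
  have := hφ (x * σ i h) y i h
  simpa using this

theorem IsSkein.eq_zero_of_right {n : ℕ} {z : R} (V : (BraidGroup n → R) → Prop)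
    (hV : ∀ φ i h, IsSkein z φ → V φ → V fun x => φ (x * σ i h))
    (hVsub : ∀ φ ψ, V φ → V ψ → V fun x => φ x - z * ψ x)
    (hV1 : ∀ φ, V φ → φ 1 = 0) {φ : BraidGroup n → R} (hφ : IsSkein z φ) (h0 : V φ) : φ = 0 := by
  have hm : ∀ g, IsSkein z fun x => φ (x * g) := fun g => by
    simpa using hφ.comp_mul 1 g
  have hinv : ∀ {ψ : BraidGroup n → R} (i h), IsSkein z ψ →
      (fun x => ψ (x * (σ i h)⁻¹)) = fun x => ψ (x * σ i h) - z * ψ x := by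
    intro ψ i h hψ
    funext x
    have := hψ x 1 i h
    simp only [mul_one] at this
    rw [this]; ring
  have key : ∀ g, V fun x => φ (x * g⁻¹) := by
    intro g
    suffices H : ∀ g : BraidGroup n, ∀ ψ : BraidGroup n → R, IsSkein z ψ → V ψ →
        V fun x => ψ (x * g) from H _ _ hφ h0
    intro g
    induction g using induction_gen with
    | h1 => intro ψ _ h; simpa using h
    | hs i h g ih =>
      intro ψ hψ hv
      have hψ' : IsSkein z fun x => ψ (x * σ i h) := by simpa using hψ.comp_mul 1 (σ i h)
      have := ih _ hψ' (hV ψ i h hψ hv)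
      simpa only [mul_assoc] using this
    | hi i h g ih =>
      intro ψ hψ hv
      have hψ' : IsSkein z fun x => ψ (x * (σ i h)⁻¹) := by simpa using hψ.comp_mul 1 (σ i h)⁻¹
      have := ih _ hψ' (by rw [hinv i h hψ]; exact hVsub _ _ (hV ψ i h hψ hv) hv)
      simpa only [mul_assoc] using this
  funext g
  have := hV1 _ (key g⁻¹)
  simpa using this

/-- A skein function on `B_{m+2}` is determined by its values on `a` and `a σ_m b`, where `a`, `b`
run through `B_{m+1}`. -/
theorem IsSkein.eq_zero {z : R} (m : ℕ) : ∀ {φ : BraidGroup (m + 2) → R}, IsSkein z φ →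
    (∀ a : BraidGroup (m + 1), φ (incl a) = 0) →
    (∀ a b : BraidGroup (m + 1), φ (incl a * σ m (by omega) * incl b) = 0) → φ = 0 := by
  induction m with
  | zero =>
    intro φ hφ h1 h2
    refine hφ.eq_zero_of_right (fun φ => (∀ a : BraidGroup (0 + 1), φ (incl a) = 0) ∧
      (∀ a b : BraidGroup (0 + 1), φ (incl a * σ 0 (by omega) * incl b) = 0)) ?_ ?_ ?_ ⟨h1, h2⟩
    · rintro φ i h hφ ⟨h1, h2⟩
      obtain rfl : i = 0 := by omega
      have hb : ∀ b : BraidGroup (0 + 1), b = 1 := by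
        intro b
        induction b using induction_gen with
        | h1 => rfl
        | hs i h => omega
        | hi i h => omega
      refine ⟨fun a => by simpa using h2 a 1, fun a b => ?_⟩
      rw [hb b]
      have e1 := mul_σ_σ hφ (incl a) 1 0 h
      have e2 := h2 a 1
      have e3 := h1 a
      simp only [mul_one, map_one] at e1 e2 ⊢
      rw [e1, e2, e3]; simp
    · rintro φ ψ ⟨h1, h2⟩ ⟨h3, h4⟩
      exact ⟨fun a => by simp [h1, h3], fun a b => by simp [h2, h4]⟩
    · rintro φ ⟨h1, -⟩; simpa using h1 1
  | succ m ih =>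
    intro φ hφ h1 h2
    refine hφ.eq_zero_of_right (fun φ => (∀ a : BraidGroup (m + 1 + 1), φ (incl a) = 0) ∧
      (∀ a b : BraidGroup (m + 1 + 1), φ (incl a * σ (m + 1) (by omega) * incl b) = 0))
      ?_ ?_ ?_ ⟨h1, h2⟩
    · rintro φ i h hφ ⟨h1, h2⟩
      by_cases hi : i = m + 1
      · subst hi
        refine ⟨fun a => by simpa using h2 a 1, fun a => ?_⟩
        suffices H : (fun b => φ (incl a * σ (m + 1) (by omega) * incl b * σ (m + 1) h)) = 0 from
          fun b => congrFun H b
        apply ih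
        · exact (hφ.comp_mul (incl a * σ (m + 1) (by omega)) (σ (m + 1) h)).comp_incl
        · intro b
          have e1 := mul_σ_σ hφ (incl a * incl (incl b)) 1 (m + 1) h
          have e2 := h2 (a * incl b) 1
          have e3 := h1 (a * incl b)
          simp only [mul_one, map_one, map_mul] at e1 e2 e3
          rw [mul_assoc (incl a), ← incl_comm_σ, ← mul_assoc, e1, e2, e3]; simp
        · intro b c
          have e := h2 (a * incl b * σ m (by omega)) (σ m (by omega) * incl c)
          have hb := σ_braid (n := m + 3) m (by omega)
          have e' : incl a * σ (m + 1) (by omega) * incl (incl b * σ m (by omega) * incl c) *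
              σ (m + 1) h = incl (a * incl b * σ m (by omega)) * σ (m + 1) (by omega) *
                incl (σ m (by omega) * incl c) := by
            simp only [map_mul, incl_σ]
            calc _ = incl a * (σ (m + 1) (by omega) * incl (incl b)) * σ m (by omega) *
                    (incl (incl c) * σ (m + 1) (by omega)) := by group
              _ = incl a * incl (incl b) * (σ (m + 1) (by omega) * σ m (by omega) *
                    σ (m + 1) (by omega)) * incl (incl c) := by
                  rw [← incl_comm_σ, incl_comm_σ c]; group
              _ = _ := by rw [← hb]; group
          show φ (_ * _ * _ * _) = 0
          rw [e', e]
      · have hi' : i + 1 < m + 1 + 1 := by omega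
        refine ⟨fun a => by simpa using h1 (a * σ i hi'), fun a b => ?_⟩
        simpa [mul_assoc] using h2 a (b * σ i hi')
    · rintro φ ψ ⟨h1, h2⟩ ⟨h3, h4⟩
      exact ⟨fun a => by simp [h1, h3], fun a b => by simp [h2, h4]⟩
    · rintro φ ⟨h1, -⟩; simpa using h1 1

end Skein

section Hecke

variable {R : Type} [CommRing R]

/-- A module with operators that satisfy the relations of the Hecke algebra of type `A_m`, a
vector and a linear form. -/
structure HeckeRep (R : Type) [CommRing R] (z : R) (m : ℕ) : Type 1 where
  M : Type
  [grp : AddCommGroup M]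
  [mod : Module R M]
  L : ℕ → M →ₗ[R] M
  quad : ∀ i a, i < m → L i (L i a) = z • L i a + a
  comm : ∀ i j a, i + 1 < j → j < m → L i (L j a) = L j (L i a)
  braid : ∀ i a, i + 1 < m → L i (L (i + 1) (L i a)) = L (i + 1) (L i (L (i + 1) a))
  one : M
  tr : M →ₗ[R] R

namespace HeckeRep

attribute [instance] HeckeRep.grp HeckeRep.mod

variable {z : R} {m : ℕ} (D : HeckeRep R z m)

/-- The invertible operator by which a generator acts. -/
def gen (i : ℕ) : (Module.End R D.M)ˣ :=
  if h : i < m then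
    { val := D.L i
      inv := D.L i - z • 1
      val_inv := by ext a; simp [D.quad i a h]
      inv_val := by ext a; simp [D.quad i a h] }
  else 1

theorem gen_val (i : ℕ) (h : i < m) : (D.gen i : Module.End R D.M) = D.L i := by simp [gen, h]

theorem gen_inv (i : ℕ) (h : i < m) :
    ((D.gen i)⁻¹ : (Module.End R D.M)ˣ).val = D.L i - z • 1 := by
  simp only [gen, h, dite_true]; rfl

/-- The action of the braid group. -/
def act : BraidGroup (m + 1) →* (Module.End R D.M)ˣ :=
  liftGen D.gen
    (by
      intro i j h hj
      ext a
      simp [D.gen_val i (by omega), D.gen_val j (by omega), D.comm i j a h (by omega)])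
    (by
      intro i h
      ext a
      simp [D.gen_val i (by omega), D.gen_val (i + 1) (by omega), D.braid i a (by omega)])

theorem act_σ (i : ℕ) (h) (a : D.M) : (D.act (σ i h)).val a = D.L i a := by
  simp [act, D.gen_val i (by omega)]

theorem act_σ_inv (i : ℕ) (h) (a : D.M) : (D.act (σ i h)⁻¹).val a = D.L i a - z • a := by
  rw [map_inv]; simp [act, D.gen_inv i (by omega)]

theorem act_mul (x y) (a : D.M) : (D.act (x * y)).val a = (D.act x).val ((D.act y).val a) := by
  simp

/-- The function on the braid group that comes from the linear form. -/
def t (β : BraidGroup (m + 1)) : R := D.tr ((D.act β).val D.one)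

theorem isSkein_t : IsSkein z D.t := by
  intro α β i h
  simp only [t, act_mul, act_σ, act_σ_inv, map_sub, map_smul, smul_eq_mul]
  ring

/-- The product `L k ∘ L (k+1) ∘ ⋯` of `r` factors. -/
def U : ℕ → ℕ → D.M →ₗ[R] D.M
  | _, 0 => LinearMap.id
  | k, r + 1 => D.L k ∘ₗ U (k + 1) r

theorem U_comm (i k r : ℕ) (a) (h : i + 1 < k) (hr : k + r ≤ m) :
    D.U k r (D.L i a) = D.L i (D.U k r a) := by
  induction r generalizing k with
  | zero => rfl
  | succ r ih =>
    simp only [U, LinearMap.comp_apply]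
    rw [ih (k + 1) (by omega) (by omega), D.comm i k _ h (by omega)]

theorem U_shift (i k r : ℕ) (a) (h : k ≤ i) (hi : i + 1 < k + r) (hr : k + r ≤ m) :
    D.U k r (D.L i a) = D.L (i + 1) (D.U k r a) := by
  induction r generalizing k with
  | zero => omega
  | succ r ih =>
    simp only [U, LinearMap.comp_apply]
    rcases h.eq_or_lt with rfl | h
    · cases r with
      | zero => omega
      | succ r =>
        simp only [U, LinearMap.comp_apply]
        rw [U_comm _ _ _ _ _ (by omega) (by omega), D.braid _ _ (by omega)]
    · rw [ih (k + 1) (by omega) (by omega) (by omega), D.comm k (i + 1) _ (by omega) (by omega)]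

/-- The inclusion of the `k`-th summand. -/
def sg (k : ℕ) : D.M →ₗ[R] (Fin (m + 2) →₀ D.M) :=
  if h : k < m + 2 then Finsupp.lsingle ⟨k, h⟩ else 0

/-- The operators of the induced representation. -/
def L' (i : ℕ) : (Fin (m + 2) →₀ D.M) →ₗ[R] (Fin (m + 2) →₀ D.M) :=
  Finsupp.lsum R fun k =>
    if (k : ℕ) = i then D.sg (i + 1) + z • D.sg i
    else if (k : ℕ) = i + 1 then D.sg i
    else if (k : ℕ) < i then D.sg k ∘ₗ D.L (i - 1) else D.sg k ∘ₗ D.L i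

theorem L'_sg (i k : ℕ) (hk : k < m + 2) (a : D.M) : D.L' i (D.sg k a) =
    if k = i then D.sg (i + 1) a + z • D.sg i a
    else if k = i + 1 then D.sg i a
    else if k < i then D.sg k (D.L (i - 1) a) else D.sg k (D.L i a) := by
  rw [sg, dif_pos hk]
  simp only [L', Finsupp.coe_lsum, Finsupp.lsingle_apply, map_zero, Finsupp.sum_single_index]
  split_ifs <;> simp only [LinearMap.add_apply, LinearMap.smul_apply, LinearMap.comp_apply, sg, hk,
    dite_true, Finsupp.lsingle_apply]

theorem L'_eq (i : ℕ) (a : D.M) (h : i < m + 1) :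
    D.L' i (D.sg i a) = D.sg (i + 1) a + z • D.sg i a := by
  rw [L'_sg _ _ _ (by omega), if_pos rfl]

theorem L'_succ (i : ℕ) (a : D.M) (h : i < m + 1) :
    D.L' i (D.sg (i + 1) a) = D.sg i a := by
  rw [L'_sg _ _ _ (by omega), if_neg (by omega), if_pos rfl]

theorem L'_lt (i k : ℕ) (a : D.M) (h : k < i) (hi : i < m + 1) :
    D.L' i (D.sg k a) = D.sg k (D.L (i - 1) a) := by
  rw [L'_sg _ _ _ (by omega), if_neg (by omega), if_neg (by omega), if_pos h]

theorem L'_gt (i k : ℕ) (a : D.M) (h : i + 1 < k) (hk : k < m + 2) :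
    D.L' i (D.sg k a) = D.sg k (D.L i a) := by
  rw [L'_sg _ _ _ (by omega), if_neg (by omega), if_neg (by omega), if_neg (by omega)]

theorem ext_sg {N : Type} [AddCommGroup N] [Module R N] {f g : (Fin (m + 2) →₀ D.M) →ₗ[R] N}
    (h : ∀ k a, k < m + 2 → f (D.sg k a) = g (D.sg k a)) (x) : f x = g x := by
  suffices f = g by rw [this]
  refine Finsupp.lhom_ext fun k a => ?_
  simpa [sg] using h k a k.2

theorem quad' (i : ℕ) (x) (h : i < m + 1) : D.L' i (D.L' i x) = z • D.L' i x + x := by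
  refine D.ext_sg (f := D.L' i ∘ₗ D.L' i) (g := z • D.L' i + LinearMap.id) (fun k a hk => ?_) x
  simp only [LinearMap.comp_apply, LinearMap.add_apply, LinearMap.smul_apply, LinearMap.id_apply]
  rcases lt_trichotomy k i with hki | rfl | hki
  · simp only [D.L'_lt i k _ hki h, D.quad (i - 1) a (by omega), map_add, map_smul]
  · simp only [D.L'_eq k _ h, D.L'_succ k _ h, map_add, map_smul, smul_add]; abel
  · rcases (Nat.succ_le_of_lt hki).eq_or_lt with rfl | hki
    · simp only [Nat.succ_eq_add_one, D.L'_eq i _ h, D.L'_succ i _ h]; abel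
    · simp only [D.L'_gt i k _ hki hk, D.quad i a (by omega), map_add, map_smul]

theorem comm' (i j : ℕ) (x) (h : i + 1 < j) (hj : j < m + 1) :
    D.L' i (D.L' j x) = D.L' j (D.L' i x) := by
  refine D.ext_sg (f := D.L' i ∘ₗ D.L' j) (g := D.L' j ∘ₗ D.L' i) (fun k a hk => ?_) x
  simp only [LinearMap.comp_apply]
  have hi : i < m + 1 := by omega
  obtain hki | rfl | rfl | ⟨h1, h2⟩ | rfl | rfl | hjk : k < i ∨ k = i ∨ k = i + 1 ∨
      (i + 1 < k ∧ k < j) ∨ k = j ∨ k = j + 1 ∨ j + 1 < k := by omega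
  · simp only [D.L'_lt i k _ hki hi, D.L'_lt j k _ (show k < j by omega) hj]
    rw [D.comm (i - 1) (j - 1) a (by omega) (by omega)]
  · simp only [D.L'_eq k _ hi, D.L'_lt j k _ (show k < j by omega) hj,
      D.L'_lt j (k + 1) _ (show k + 1 < j by omega) hj, map_add, map_smul]
  · simp only [D.L'_succ i _ hi, D.L'_lt j i _ (show i < j by omega) hj,
      D.L'_lt j (i + 1) _ (show i + 1 < j by omega) hj]
  · simp only [D.L'_gt i k _ h1 hk, D.L'_lt j k _ h2 hj]
    rw [D.comm i (j - 1) a (by omega) (by omega)]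
  · simp only [D.L'_eq k _ hj, D.L'_gt i k _ h (by omega),
      D.L'_gt i (k + 1) _ (show i + 1 < k + 1 by omega) (by omega), map_add, map_smul]
  · simp only [D.L'_succ j _ hj, D.L'_gt i j _ h (by omega),
      D.L'_gt i (j + 1) _ (show i + 1 < j + 1 by omega) (by omega)]
  · simp only [D.L'_gt i k _ (show i + 1 < k by omega) hk, D.L'_gt j k _ hjk hk]
    rw [D.comm i j a h (by omega)]

theorem braid' (i : ℕ) (x) (h : i + 1 < m + 1) :
    D.L' i (D.L' (i + 1) (D.L' i x)) = D.L' (i + 1) (D.L' i (D.L' (i + 1) x)) := by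
  refine D.ext_sg (f := D.L' i ∘ₗ D.L' (i + 1) ∘ₗ D.L' i)
    (g := D.L' (i + 1) ∘ₗ D.L' i ∘ₗ D.L' (i + 1)) (fun k a hk => ?_) x
  simp only [LinearMap.comp_apply]
  have hi : i < m + 1 := by omega
  have e1 : ∀ a, D.L' i (D.sg (i + 1 + 1) a) = D.sg (i + 1 + 1) (D.L i a) := fun a =>
    D.L'_gt i _ a (by omega) (by omega)
  have e2 : ∀ a, D.L' (i + 1) (D.sg i a) = D.sg i (D.L i a) := fun a =>
    D.L'_lt (i + 1) i a (by omega) h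
  obtain hki | rfl | rfl | rfl | hjk : k < i ∨ k = i ∨ k = i + 1 ∨ k = i + 1 + 1 ∨
      i + 1 + 1 < k := by omega
  · simp only [D.L'_lt i k _ hki hi, D.L'_lt (i + 1) k _ (show k < i + 1 by omega) h]
    have := D.braid (i - 1) a (by omega)
    rw [show i - 1 + 1 = i by omega] at this
    rw [show i + 1 - 1 = i by omega, this]
  · simp only [D.L'_eq k _ hi, D.L'_succ k _ hi, D.L'_eq (k + 1) _ h,
      e1, e2, map_add, map_smul, smul_add, D.quad k a (by omega)]
    try abel
  · simp only [D.L'_eq i _ hi, D.L'_succ i _ hi, D.L'_eq (i + 1) _ h, D.L'_succ (i + 1) _ h,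
      e1, e2, map_add, map_smul]
    try abel
  · simp only [D.L'_succ i _ hi, D.L'_succ (i + 1) _ h, e1, e2]
    try abel
  · simp only [D.L'_gt i k _ (show i + 1 < k by omega) hk, D.L'_gt (i + 1) k _ hjk hk]
    rw [D.braid i a (by omega)]

/-- The conditional expectation, for the parameters `vi` and `δ` of a Markov trace. -/
def E (vi δ : R) : (Fin (m + 2) →₀ D.M) →ₗ[R] D.M :=
  Finsupp.lsum R fun k => if (k : ℕ) = m + 1 then δ • LinearMap.id else vi • D.U k (m - k)

theorem E_last (vi δ : R) (a : D.M) : D.E vi δ (D.sg (m + 1) a) = δ • a := by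
  simp [sg, E]

theorem E_lt (vi δ : R) (k : ℕ) (hk : k < m + 1) (a : D.M) :
    D.E vi δ (D.sg k a) = vi • D.U k (m - k) a := by
  have h1 : k < m + 2 := by omega
  have h2 : k ≠ m + 1 := by omega
  simp [sg, E, h1, h2]

theorem E_L' (vi δ : R) (i : ℕ) (hi : i < m) (x) :
    D.E vi δ (D.L' i x) = D.L i (D.E vi δ x) := by
  refine D.ext_sg (f := D.E vi δ ∘ₗ D.L' i) (g := D.L i ∘ₗ D.E vi δ) (fun k a hk => ?_) x
  simp only [LinearMap.comp_apply]
  have hi' : i < m + 1 := by omega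
  have hU : ∀ a, D.U i (m - i) a = D.L i (D.U (i + 1) (m - (i + 1)) a) := by
    intro a
    rw [show m - i = m - (i + 1) + 1 by omega]; rfl
  obtain hki | rfl | rfl | ⟨h1, h2⟩ | rfl : k < i ∨ k = i ∨ k = i + 1 ∨
      (i + 1 < k ∧ k < m + 1) ∨ k = m + 1 := by omega
  · rw [D.L'_lt i k _ hki hi', E_lt _ _ _ _ (by omega), E_lt _ _ _ _ (by omega), map_smul,
      D.U_shift _ _ _ _ (by omega) (by omega) (by omega), show i - 1 + 1 = i by omega]
  · rw [D.L'_eq k _ hi', map_add, map_smul, E_lt _ _ _ _ (by omega), E_lt _ _ _ _ (by omega),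
      map_smul, hU a, D.quad _ _ hi, smul_add, smul_comm z vi, add_comm]
  · rw [D.L'_succ i _ hi', E_lt _ _ _ _ (by omega), E_lt _ _ _ _ (by omega), map_smul, hU a]
  · rw [D.L'_gt i k _ h1 hk, E_lt _ _ _ _ (by omega), E_lt _ _ _ _ (by omega), map_smul,
      D.U_comm _ _ _ _ h1 (by omega)]
  · rw [D.L'_gt i _ _ (by omega) hk, E_last, E_last, map_smul]

/-- The induced representation, with the induced trace. -/
def succ (vi δ : R) : HeckeRep R z (m + 1) where
  M := Fin (m + 2) →₀ D.M
  L := D.L'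
  quad := D.quad'
  comm := D.comm'
  braid := D.braid'
  one := D.sg (m + 1) D.one
  tr := D.tr ∘ₗ D.E vi δ

/-- `sg k`, as a map into the induced representation. -/
def inc (vi δ : R) (k : ℕ) : D.M →ₗ[R] (D.succ vi δ).M := D.sg k

/-- `E`, as a map from the induced representation. -/
def exp (vi δ : R) : (D.succ vi δ).M →ₗ[R] D.M := D.E vi δ

theorem L_inc_last (vi δ : R) (i : ℕ) (h : i < m) (x : D.M) :
    (D.succ vi δ).L i (D.inc vi δ (m + 1) x) = D.inc vi δ (m + 1) (D.L i x) :=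
  D.L'_gt _ _ _ (by omega) (by omega)

theorem exp_L (vi δ : R) (i : ℕ) (h : i < m) (x : (D.succ vi δ).M) :
    D.exp vi δ ((D.succ vi δ).L i x) = D.L i (D.exp vi δ x) :=
  D.E_L' vi δ i h x

theorem L_last (vi δ : R) (x : D.M) :
    (D.succ vi δ).L m (D.inc vi δ (m + 1) x) = D.inc vi δ m x :=
  D.L'_succ m _ (by omega)

theorem exp_last (vi δ : R) (x : D.M) : D.exp vi δ (D.inc vi δ (m + 1) x) = δ • x :=
  D.E_last vi δ x

theorem exp_pred (vi δ : R) (x : D.M) : D.exp vi δ (D.inc vi δ m x) = vi • x := by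
  have := D.E_lt vi δ m (by omega) x
  rw [Nat.sub_self] at this
  exact this

theorem t_succ (vi δ : R) (β) : (D.succ vi δ).t β =
    D.tr (D.exp vi δ (((D.succ vi δ).act β).val (D.inc vi δ (m + 1) D.one))) := rfl

theorem act_incl_inc (vi δ : R) (a : BraidGroup (m + 1)) : ∀ x : D.M,
    ((D.succ vi δ).act (incl a)).val (D.inc vi δ (m + 1) x) =
      D.inc vi δ (m + 1) ((D.act a).val x) := by
  induction a using induction_gen with
  | h1 => intro x; simp
  | hs i h g ih =>
    intro x
    rw [map_mul, act_mul, act_mul, incl_σ, act_σ, act_σ, D.L_inc_last _ _ _ (by omega), ih]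
  | hi i h g ih =>
    intro x
    rw [map_mul, act_mul, act_mul, map_inv, incl_σ, act_σ_inv, act_σ_inv,
      D.L_inc_last _ _ _ (by omega), ← map_smul, ← map_sub, ih]

theorem exp_act_incl (vi δ : R) (a : BraidGroup (m + 1)) : ∀ x : (D.succ vi δ).M,
    D.exp vi δ (((D.succ vi δ).act (incl a)).val x) = (D.act a).val (D.exp vi δ x) := by
  induction a using induction_gen with
  | h1 => intro x; simp
  | hs i h g ih =>
    intro x
    rw [map_mul, act_mul, act_mul, incl_σ, act_σ, act_σ, ih, D.exp_L _ _ _ (by omega)]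
  | hi i h g ih =>
    intro x
    rw [map_mul, act_mul, act_mul, map_inv, incl_σ, act_σ_inv, act_σ_inv, ih,
      ← D.exp_L _ _ _ (by omega), map_sub, map_smul]

theorem t_succ_incl (vi δ : R) (a : BraidGroup (m + 1)) :
    (D.succ vi δ).t (incl a) = δ * D.t a := by
  rw [t_succ, act_incl_inc, exp_last, map_smul]; rfl

theorem t_succ_incl_σ_incl (vi δ : R) (a b : BraidGroup (m + 1)) :
    (D.succ vi δ).t (incl a * σ m (by omega) * incl b) = vi * D.t (a * b) := by
  rw [t_succ, act_mul, act_mul, act_incl_inc, exp_act_incl, act_σ, L_last, exp_pred]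
  simp only [map_smul, t, act_mul, smul_eq_mul]

/-- The family of representations that starts with the ground ring. -/
def tower (z vi δ : R) : ∀ m, HeckeRep R z m
  | 0 => { M := R, L := fun _ => 0, quad := by simp, comm := by simp, braid := by simp
           one := 1, tr := LinearMap.id }
  | m + 1 => (tower z vi δ m).succ vi δ

end HeckeRep

/-- The Markov trace on the braid group on `m + 1` strands. -/
def markovTrace (z vi δ : R) (m : ℕ) : BraidGroup (m + 1) → R := (HeckeRep.tower z vi δ m).t

variable {z vi δ : R}

theorem markovTrace_skein (m : ℕ) : IsSkein z (markovTrace z vi δ m) :=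
  HeckeRep.isSkein_t _

theorem markovTrace_incl (m : ℕ) (a : BraidGroup (m + 1)) :
    markovTrace z vi δ (m + 1) (incl a) = δ * markovTrace z vi δ m a :=
  HeckeRep.t_succ_incl _ _ _ _

theorem markovTrace_incl_σ_incl (m : ℕ) (a b : BraidGroup (m + 1)) :
    markovTrace z vi δ (m + 1) (incl a * σ m (by omega) * incl b) =
      vi * markovTrace z vi δ m (a * b) :=
  HeckeRep.t_succ_incl_σ_incl _ _ _ _ _

theorem markovTrace_one : markovTrace z vi δ 0 1 = 1 := by
  rw [markovTrace, HeckeRep.t, map_one]; rfl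

theorem mul_comm_of_gen {n : ℕ} {S : Type} {φ : BraidGroup n → S}
    (h : ∀ i hi x, φ (x * σ i hi) = φ (σ i hi * x)) (x y : BraidGroup n) :
    φ (x * y) = φ (y * x) := by
  induction y using induction_gen generalizing x with
  | h1 => simp
  | hs i hi y ih => rw [← mul_assoc, h, ← mul_assoc, ih, mul_assoc]
  | hi i hi y ih =>
    have h' : ∀ x, φ (x * (σ i hi)⁻¹) = φ ((σ i hi)⁻¹ * x) := by
      intro x
      have := h i hi ((σ i hi)⁻¹ * x * (σ i hi)⁻¹)
      simpa [mul_assoc] using this.symm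
    rw [← mul_assoc, h', ← mul_assoc, ih, mul_assoc]

theorem braid_one (b : BraidGroup (0 + 1)) : b = 1 := by
  induction b using induction_gen with
  | h1 => rfl
  | hs i h => omega
  | hi i h => omega

/-- The value of the trace on `a σ b σ`. -/
theorem markovTrace_right_incl (m : ℕ) (a : BraidGroup (m + 2)) (b : BraidGroup (m + 1)) :
    markovTrace z vi δ (m + 2) (incl a * σ (m + 1) (by omega) * incl (incl b) *
      σ (m + 1) (by omega)) = (z * vi + δ) * markovTrace z vi δ (m + 1) (a * incl b) := by
  have e1 := mul_σ_σ (markovTrace_skein (z := z) (vi := vi) (δ := δ) (m + 2))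
    (incl (a * incl b)) 1 (m + 1) (by omega)
  have e2 := markovTrace_incl_σ_incl (z := z) (vi := vi) (δ := δ) (m + 1) (a * incl b) 1
  have e3 := markovTrace_incl (z := z) (vi := vi) (δ := δ) (m + 1) (a * incl b)
  rw [mul_assoc (incl a), ← incl_comm_σ, ← mul_assoc, ← map_mul]
  simp only [mul_one, map_one] at e1 e2
  rw [e1, e2, e3]; ring

theorem markovTrace_right (m : ℕ) (a : BraidGroup (m + 2)) (b c : BraidGroup (m + 1)) :
    markovTrace z vi δ (m + 2) (incl a * σ (m + 1) (by omega) *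
      incl (incl b * σ m (by omega) * incl c) * σ (m + 1) (by omega)) =
    vi * (z * markovTrace z vi δ (m + 1) (a * (incl b * σ m (by omega) * incl c)) +
      markovTrace z vi δ (m + 1) (a * (incl b * incl c))) := by
  have hb := σ_braid (n := m + 3) m (by omega)
  have e' : incl a * σ (m + 1) (by omega) * incl (incl b * σ m (by omega) * incl c) *
      σ (m + 1) (by omega) = incl (a * incl b * σ m (by omega)) * σ (m + 1) (by omega) *
        incl (σ m (by omega) * incl c) := by
    simp only [map_mul, incl_σ]
    calc _ = incl a * (σ (m + 1) (by omega) * incl (incl b)) * σ m (by omega) *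
            (incl (incl c) * σ (m + 1) (by omega)) := by group
      _ = incl a * incl (incl b) * (σ (m + 1) (by omega) * σ m (by omega) *
            σ (m + 1) (by omega)) * incl (incl c) := by
          rw [← incl_comm_σ, incl_comm_σ c]; group
      _ = _ := by rw [← hb]; group
  have e1 := mul_σ_σ (markovTrace_skein (z := z) (vi := vi) (δ := δ) (m + 1))
    (a * incl b) (incl c) m (by omega)
  rw [e', markovTrace_incl_σ_incl, ← mul_assoc _ (σ m _), e1]
  simp only [mul_assoc]

theorem markovTrace_left_incl (m : ℕ) (a : BraidGroup (m + 1)) (b : BraidGroup (m + 2)) :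
    markovTrace z vi δ (m + 2) (σ (m + 1) (by omega) * (incl (incl a) * σ (m + 1) (by omega) *
      incl b)) = (z * vi + δ) * markovTrace z vi δ (m + 1) (incl a * b) := by
  have e1 := mul_σ_σ (markovTrace_skein (z := z) (vi := vi) (δ := δ) (m + 2))
    (incl (incl a)) (incl b) (m + 1) (by omega)
  have e2 := markovTrace_incl_σ_incl (z := z) (vi := vi) (δ := δ) (m + 1) (incl a) b
  have e3 := markovTrace_incl (z := z) (vi := vi) (δ := δ) (m + 1) (incl a * b)
  rw [← mul_assoc, ← mul_assoc, ← incl_comm_σ]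
  rw [map_mul] at e3
  rw [e1, e2, e3]; ring

theorem markovTrace_left (m : ℕ) (a b : BraidGroup (m + 1)) (c : BraidGroup (m + 2)) :
    markovTrace z vi δ (m + 2) (σ (m + 1) (by omega) *
      (incl (incl a * σ m (by omega) * incl b) * σ (m + 1) (by omega) * incl c)) =
    vi * (z * markovTrace z vi δ (m + 1) (incl a * σ m (by omega) * incl b * c) +
      markovTrace z vi δ (m + 1) (incl a * incl b * c)) := by
  have hb := σ_braid (n := m + 3) m (by omega)
  have e' : σ (m + 1) (by omega) * (incl (incl a * σ m (by omega) * incl b) *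
      σ (m + 1) (by omega) * incl c) = incl (incl a * σ m (by omega)) * σ (m + 1) (by omega) *
        incl (σ m (by omega) * incl b * c) := by
    simp only [map_mul, incl_σ]
    calc _ = (σ (m + 1) (by omega) * incl (incl a)) * σ m (by omega) *
            (incl (incl b) * σ (m + 1) (by omega)) * incl c := by group
      _ = incl (incl a) * (σ (m + 1) (by omega) * σ m (by omega) *
            σ (m + 1) (by omega)) * incl (incl b) * incl c := by
          rw [← incl_comm_σ, incl_comm_σ b]; group
      _ = _ := by rw [← hb]; group
  have e1 := mul_σ_σ (markovTrace_skein (z := z) (vi := vi) (δ := δ) (m + 1))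
    (incl a) (incl b * c) m (by omega)
  simp only [mul_assoc] at e1
  rw [e', markovTrace_incl_σ_incl]
  simp only [mul_assoc]
  rw [e1]

theorem markovTrace_comm_last (m : ℕ) (a b : BraidGroup (m + 1)) :
    markovTrace z vi δ (m + 1) (incl a * σ m (by omega) * incl b * σ m (by omega)) =
      markovTrace z vi δ (m + 1) (σ m (by omega) * (incl a * σ m (by omega) * incl b)) := by
  cases m with
  | zero => rw [braid_one a, braid_one b]; simp
  | succ m =>
    set t := markovTrace z vi δ (m + 1 + 1) with ht
    have hsk : IsSkein z t := markovTrace_skein _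
    have hA : ∀ b : BraidGroup (m + 1 + 1), IsSkein z fun a : BraidGroup (m + 1 + 1) =>
        t (incl a * σ (m + 1) (by omega) * incl b * σ (m + 1) (by omega)) -
        t (σ (m + 1) (by omega) * (incl a * σ (m + 1) (by omega) * incl b)) := by
      intro b
      have h1 := (hsk.comp_mul 1
        (σ (m + 1) (by omega) * incl b * σ (m + 1) (by omega))).comp_incl
      have h2 := (hsk.comp_mul (σ (m + 1) (by omega))
        (σ (m + 1) (by omega) * incl b)).comp_incl
      simpa [mul_assoc] using h1.sub h2
    have hB : ∀ a : BraidGroup (m + 1 + 1), IsSkein z fun b : BraidGroup (m + 1 + 1) =>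
        t (incl a * σ (m + 1) (by omega) * incl b * σ (m + 1) (by omega)) -
        t (σ (m + 1) (by omega) * (incl a * σ (m + 1) (by omega) * incl b)) := by
      intro a
      have h1 := (hsk.comp_mul (incl a * σ (m + 1) (by omega))
        (σ (m + 1) (by omega))).comp_incl
      have h2 := (hsk.comp_mul (σ (m + 1) (by omega) * (incl a * σ (m + 1) (by omega)))
        1).comp_incl
      simpa [mul_assoc] using h1.sub h2
    rw [← sub_eq_zero]
    refine congrFun ((hA b).eq_zero m (fun a => ?_) (fun a a' => ?_)) a
    · refine congrFun ((hB (incl a)).eq_zero m (fun b => ?_) (fun b b' => ?_)) b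
      · rw [ht, markovTrace_right_incl, markovTrace_left_incl, sub_self]
      · rw [ht, markovTrace_right, markovTrace_left_incl]
        have e1 := markovTrace_incl_σ_incl (z := z) (vi := vi) (δ := δ) m (a * b) b'
        have e2 := markovTrace_incl (z := z) (vi := vi) (δ := δ) m (a * b * b')
        simp only [map_mul, mul_assoc] at e1 e2 ⊢
        rw [e1, e2]; ring
    · refine congrFun ((hB (incl a * σ m (by omega) * incl a')).eq_zero m
        (fun b => ?_) (fun b b' => ?_)) b
      · rw [ht, markovTrace_right_incl, markovTrace_left]
        have e1 := markovTrace_incl_σ_incl (z := z) (vi := vi) (δ := δ) m a (a' * b)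
        have e2 := markovTrace_incl (z := z) (vi := vi) (δ := δ) m (a * a' * b)
        simp only [map_mul, mul_assoc] at e1 e2 ⊢
        rw [e1, e2]; ring
      · rw [ht, markovTrace_right, markovTrace_left]
        have e1 := markovTrace_incl_σ_incl (z := z) (vi := vi) (δ := δ) m a (a' * b * b')
        have e2 := markovTrace_incl_σ_incl (z := z) (vi := vi) (δ := δ) m (a * a' * b) b'
        simp only [map_mul, mul_assoc] at e1 e2 ⊢
        rw [e1, e2, sub_self]

theorem markovTrace_comm (m : ℕ) (x y : BraidGroup (m + 1)) :
    markovTrace z vi δ m (x * y) = markovTrace z vi δ m (y * x) := by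
  induction m with
  | zero => exact mul_comm_of_gen (fun i hi => by omega) x y
  | succ m ih =>
    refine mul_comm_of_gen (fun i hi x => ?_) x y
    set t := markovTrace z vi δ (m + 1) with ht
    have hsk : IsSkein z t := markovTrace_skein _
    suffices H : (fun x => t (x * σ i hi) - t (σ i hi * x)) = 0 from
      sub_eq_zero.1 (congrFun H x)
    have hs1 : IsSkein z fun x => t (x * σ i hi) := by simpa using hsk.comp_mul 1 (σ i hi)
    have hs2 : IsSkein z fun x => t (σ i hi * x) := by simpa using hsk.comp_mul (σ i hi) 1
    by_cases h : i = m
    · subst h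
      refine (hs1.sub hs2).eq_zero i (fun a => ?_) (fun a b => ?_)
      · have e1 := markovTrace_incl_σ_incl (z := z) (vi := vi) (δ := δ) i a 1
        have e2 := markovTrace_incl_σ_incl (z := z) (vi := vi) (δ := δ) i 1 a
        simp only [map_one, one_mul, mul_one] at e1 e2
        rw [ht, e1, e2, sub_self]
      · rw [ht, markovTrace_comm_last, sub_self]
    · have hi' : i + 1 < m + 1 := by omega
      refine (hs1.sub hs2).eq_zero m (fun a => ?_) (fun a b => ?_)
      · have e1 := markovTrace_incl (z := z) (vi := vi) (δ := δ) m (a * σ i hi')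
        have e2 := markovTrace_incl (z := z) (vi := vi) (δ := δ) m (σ i hi' * a)
        simp only [map_mul, incl_σ] at e1 e2
        rw [ht, e1, e2, ih, sub_self]
      · have e1 := markovTrace_incl_σ_incl (z := z) (vi := vi) (δ := δ) m a (b * σ i hi')
        have e2 := markovTrace_incl_σ_incl (z := z) (vi := vi) (δ := δ) m (σ i hi' * a) b
        simp only [map_mul, incl_σ, mul_assoc] at e1 e2 ⊢
        rw [ht, e1, e2, ← mul_assoc, ih, sub_self]

end Hecke

theorem writhe_mul {n : ℕ} (α β : BraidGroup n) : writhe (α * β) = writhe α + writhe β := by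
  simp [writhe]

theorem writhe_inv {n : ℕ} (α : BraidGroup n) : writhe α⁻¹ = -writhe α := by
  simp [writhe]

theorem writhe_σ {n : ℕ} (i : ℕ) (h : i + 1 < n) : writhe (σ i h) = 1 := by
  simp [writhe, writheHom]

theorem writhe_incl {n : ℕ} (β : BraidGroup n) : writhe (incl β) = writhe β := by
  have : (writheHom (n + 1)).comp incl = writheHom n :=
    hom_ext fun i h => by simp [writheHom]
  exact congrArg Multiplicative.toAdd (DFunLike.congr_fun this β)

open LaurentPolynomial in
/-- The value of the Homflypt polynomial on a closed braid, as a normalized Markov trace. -/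
def braidHomflypt : ClosedBraid → LaurentVZ
  | ⟨0, _, _⟩ => 0
  | ⟨m + 1, _, β⟩ =>
      T (writhe β) * markovTrace varZ (T (-1)) (C (T (-1)) * (T (-1) - T 1)) m β

open LaurentPolynomial in
theorem braidHomflypt_markov {a b : ClosedBraid} (h : MarkovMove a b) :
    braidHomflypt a = braidHomflypt b := by
  cases h with
  | conj n hn α β =>
    obtain ⟨m, rfl⟩ : ∃ m, n = m + 1 := ⟨n - 1, by omega⟩
    simp only [braidHomflypt, writhe_mul, add_comm (writhe α), markovTrace_comm m α β]
  | stabPos n hn β =>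
    obtain ⟨m, rfl⟩ : ∃ m, n = m + 1 := ⟨n - 1, by omega⟩
    simp only [braidHomflypt, writhe_mul, writhe_incl, writhe_σ]
    have e := markovTrace_incl_σ_incl (z := varZ) (vi := T (-1))
      (δ := C (T (-1)) * (T (-1) - T 1)) m β 1
    simp only [map_one, mul_one] at e
    rw [show σ (m + 1 - 1) (by omega) = σ (n := m + 1 + 1) m (by omega) from rfl, e, ← mul_assoc,
      ← T_add]
    simp
  | stabNeg n hn β =>
    obtain ⟨m, rfl⟩ : ∃ m, n = m + 1 := ⟨n - 1, by omega⟩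
    simp only [braidHomflypt, writhe_mul, writhe_inv, writhe_incl, writhe_σ]
    have e := markovTrace_incl_σ_incl (z := varZ) (vi := T (-1))
      (δ := C (T (-1)) * (T (-1) - T 1)) m β 1
    have e2 := markovTrace_incl (z := varZ) (vi := T (-1))
      (δ := C (T (-1)) * (T (-1) - T 1)) m β
    have e3 := markovTrace_skein (z := varZ) (vi := T (-1))
      (δ := C (T (-1)) * (T (-1) - T 1)) (m + 1) (incl β) 1 m (by omega)
    simp only [map_one, mul_one] at e e2 e3
    rw [e, e2] at e3
    rw [show σ (m + 1 - 1) (by omega) = σ (n := m + 1 + 1) m (by omega) from rfl,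
      ← sub_eq_of_eq_add' e3]
    have hz : varZ * C (T (-1)) = 1 := by
      rw [varZ, ← map_mul, ← T_add]; simp
    have hT : (T (writhe β + -1) : LaurentVZ) * T 1 = T (writhe β) := by
      rw [← T_add]; simp
    rw [← hT]
    linear_combination (-1 : LaurentVZ) * T (writhe β + -1) * markovTrace varZ (T (-1))
      (C (T (-1)) * (T (-1) - T 1)) m β * (T 1 - T (-1)) * hz

open LaurentPolynomial in
theorem exists_isHomflypt : ∃ P, IsHomflypt P := by
  refine ⟨Quot.lift braidHomflypt fun a b h => braidHomflypt_markov h, ?_, ?_⟩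
  · show T (writhe (1 : BraidGroup 1)) * markovTrace _ _ _ 0 1 = 1
    rw [markovTrace_one]; simp [writhe]
  · intro n hn α β i hi
    obtain ⟨m, rfl⟩ : ∃ m, n = m + 1 := ⟨n - 1, by omega⟩
    show T _ * markovTrace _ _ _ m _ = varV * varZ * (T _ * markovTrace _ _ _ m _) +
      varV ^ 2 * (T _ * markovTrace _ _ _ m _)
    rw [markovTrace_skein m α β i hi]
    simp only [writhe_mul, writhe_inv, writhe_σ, varV]
    rw [show writhe α + 1 + writhe β = 1 + (writhe α + writhe β) by ring,
      show writhe α + -1 + writhe β = -1 + (writhe α + writhe β) by ring, T_add 1, T_add (-1)]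
    have h1 : (T 1 : LaurentVZ) * T (-1) = 1 := by rw [← T_add]; simp
    linear_combination (-(T 1 : LaurentVZ) * T (writhe α + writhe β) *
      markovTrace varZ (T (-1)) (C (T (-1)) * (T (-1) - T 1)) m (α * (σ i hi)⁻¹ * β)) * h1

open LaurentPolynomial in
theorem IsHomflypt.unique {P Q : OrientedLink → LaurentVZ} (hP : IsHomflypt P)
    (hQ : IsHomflypt Q) : P = Q := by
  have key : ∀ (m : ℕ) (β : BraidGroup (m + 1)),
      P (braidClosure m.succ_pos β) = Q (braidClosure m.succ_pos β) := by
    intro m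
    induction m with
    | zero => intro β; rw [braid_one β]; exact hP.unknot.trans hQ.unknot.symm
    | succ m ih =>
      have hpos : ∀ β : BraidGroup (m + 1), braidClosure (m + 1).succ_pos
          (incl β * σ m (by omega)) = braidClosure m.succ_pos β := fun β =>
        (Quot.sound (MarkovMove.stabPos (m + 1) m.succ_pos β)).symm
      have hneg : ∀ β : BraidGroup (m + 1), braidClosure (m + 1).succ_pos
          (incl β * (σ m (by omega))⁻¹) = braidClosure m.succ_pos β := fun β =>
        (Quot.sound (MarkovMove.stabNeg (m + 1) m.succ_pos β)).symm
      have hconj : ∀ α β : BraidGroup (m + 1 + 1), braidClosure (m + 1).succ_pos (α * β) =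
          braidClosure (m + 1).succ_pos (β * α) := fun α β =>
        Quot.sound (MarkovMove.conj _ _ α β)
      have hinv : ∀ n : ℤ, (T (-n) : LaurentVZ) * T n = 1 := fun n => by rw [← T_add]; simp
      suffices H : (fun β : BraidGroup (m + 2) => (T (-writhe β) : LaurentVZ) *
          (P (braidClosure (m + 1).succ_pos β) - Q (braidClosure (m + 1).succ_pos β))) = 0 by
        intro β
        have := congrFun H β
        have h2 := congrArg (T (writhe β) * ·) this
        simp only [Pi.zero_apply, mul_zero, ← mul_assoc, ← T_add] at h2
        simpa [sub_eq_zero] using h2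
      apply IsSkein.eq_zero (z := varZ) m
      · intro α β i h
        simp only [hP.skein, hQ.skein, writhe_mul, writhe_inv, writhe_σ, varV]
        rw [show -(writhe α + 1 + writhe β) = -1 + -(writhe α + writhe β) by ring,
          show -(writhe α + -1 + writhe β) = 1 + -(writhe α + writhe β) by ring,
          T_add 1, T_add (-1)]
        have h1 := hinv 1
        linear_combination (varZ * T (-(writhe α + writhe β)) *
          (P (braidClosure (m + 1).succ_pos (α * β)) - Q (braidClosure (m + 1).succ_pos (α * β))) +
          T 1 * T (-(writhe α + writhe β)) *
          (P (braidClosure (m + 1).succ_pos (α * (σ i h)⁻¹ * β)) -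
            Q (braidClosure (m + 1).succ_pos (α * (σ i h)⁻¹ * β)))) * h1
      · intro a
        have h1 := hP.skein _ (m + 1).succ_pos (incl a) 1 m (by omega)
        have h2 := hQ.skein _ (m + 1).succ_pos (incl a) 1 m (by omega)
        simp only [mul_one, hpos, hneg, ih] at h1 h2
        have h3 : varV * varZ * (P (braidClosure (m + 1).succ_pos (incl a)) -
            Q (braidClosure (m + 1).succ_pos (incl a))) = 0 := by
          linear_combination h2 - h1
        have hu : (T (-1) * C (T (-1)) : LaurentVZ) * (varV * varZ) = 1 := by
          rw [varV, varZ, mul_mul_mul_comm, ← map_mul, ← T_add, ← T_add]; simp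
        linear_combination (T (-writhe (incl a)) * (T (-1) * C (T (-1)))) * h3 -
          T (-writhe (incl a)) * (P (braidClosure (m + 1).succ_pos (incl a)) -
            Q (braidClosure (m + 1).succ_pos (incl a))) * hu
      · intro a b
        rw [hconj, ← mul_assoc, ← map_mul, hpos, ih, sub_self, mul_zero]
  funext L
  induction L using Quot.ind with
  | mk c =>
    obtain ⟨n, hn, β⟩ := c
    obtain ⟨m, rfl⟩ : ∃ m, n = m + 1 := ⟨n - 1, by omega⟩
    exact key m β

/-- There is exactly one Homflypt polynomial. -/
theorem existsUnique_isHomflypt : ∃! P, IsHomflypt P := by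
  obtain ⟨P, hP⟩ := exists_isHomflypt
  exact ⟨P, hP, fun _ hQ => hQ.unique hP⟩

/-- The Homflypt polynomial `P(v, z)` of an oriented link. -/
def homflypt : OrientedLink → LaurentVZ := existsUnique_isHomflypt.choose

theorem homflypt_spec : IsHomflypt homflypt := existsUnique_isHomflypt.choose_spec.1

/-! ### The polynomials derived from it -/

/-- The Conway polynomial `∇(z) = P(1, z)`. -/
def conway (L : OrientedLink) : ℤ[T;T⁻¹] :=
  LaurentPolynomial.eval₂ (RingHom.id ℤ[T;T⁻¹]) 1 (homflypt L)

/-- The Conway polynomial `C_p` of the elementary torus link with `p` half twists on two strands,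
the closure of the `p`-th power of the generator of the braid group on two strands. -/
def torusConway (p : ℤ) : ℤ[T;T⁻¹] :=
  conway (braidClosure two_pos ((σ 0 one_lt_two : BraidGroup 2) ^ p))

/-- The Laurent coefficient polynomial `h_j(z)` of a closed braid on `n` strands with writhe `w`:
the coefficient of `v ^ (w - n + 1 + 2 * j)` in the Homflypt polynomial. -/
def laurentCoeff {n : ℕ} (hn : 0 < n) (β : BraidGroup n) (j : Fin n) : ℤ[T;T⁻¹] :=
  (homflypt (braidClosure hn β)).coeff (writhe β - n + 1 + 2 * (j : ℕ))

section Relations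

variable {n : ℕ} {A : Type*} [CommRing A] [Algebra ℤ[T;T⁻¹] A]

/-- The first linear relation, `∑ C_{2j-3} f_j = C_{4+w-n}`. -/
def FirstRelation (w : ℤ) (f : Fin n → A) : Prop :=
  ∑ j : Fin n, algebraMap ℤ[T;T⁻¹] A (torusConway (2 * (j : ℕ) - 3)) * f j =
    algebraMap ℤ[T;T⁻¹] A (torusConway (4 + w - n))

/-- The second linear relation, `∑ C_{2j-1} f_j = C_{2+w-n}`. -/
def SecondRelation (w : ℤ) (f : Fin n → A) : Prop :=
  ∑ j : Fin n, algebraMap ℤ[T;T⁻¹] A (torusConway (2 * (j : ℕ) - 1)) * f j =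
    algebraMap ℤ[T;T⁻¹] A (torusConway (2 + w - n))

end Relations

end HomflyBraid
end

/-!
Write `τ(β) = v^{-w(β)} P(β̂)`. In this normalization the skein relation is that of the Hecke
algebra, `τ(α σ β) = z τ(α β) + τ(α σ⁻¹ β)`, and the Markov moves become
`τ(a σ_m b) = v⁻¹ τ(a b)` and `τ(a) = z⁻¹ (v⁻¹ - v) τ(a)` for `a`, `b` on one strand less
(`normHomflypt_incl_σ_incl`, `normHomflypt_incl`). A function on the braid group that satisfies the
skein relation is determined by its values on braids of these two forms (`IsSkein.eq_zero`), so that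
a `ℤ[z, z⁻¹]`-linear statement about `τ(β)` may be proved by induction on the number of strands,
checking these two forms only. The form of `P` and the relations are both of this kind.

* On `m + 1` strands, `τ(β)` involves only the powers `v^{-m}, v^{-m+2}, …, v^m`
  (`coeff_normHomflypt_eq_zero`). This gives the form of `P`, the bounds of Morton and of
  Franks and Williams.
* For `c ∈ ℤ` let `Λ_c` be the linear form with `Λ_c(v^k) = C_{k+c}`. Since `C_p` satisfies the
  recursion `C_{p+1} = z C_p + C_{p-1}`, one finds `Λ_c(τ(β)) = (-1)^{m+c+1} C_{w(β)-c}`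
  (`torusForm_normHomflypt`); the first and the second relation are the cases `c = m - 3` and
  `c = m - 1`.

For the last part, both sides of the relation, as functions of `κ`, satisfy
`S_κ = z S_{κ+1} + S_{κ+2}`; they agree for `κ = 0` by the second relation and for `κ = 2` by the
first, hence for `κ = 1` as `z` is invertible, hence everywhere (`eq_of_recursion`). The
independence is seen on solutions supported on the first two indices, because `C_{-3} = z² + 1`
and `C_{-1} = C_1 = 1`.
-/

namespace HomflyBraid

open LaurentPolynomial

/-! ### Sequences with the recursion of the Conway polynomials of torus links -/

/-- A solution of the recursion on all of `ℤ` is determined by two neighbouring values. -/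
theorem eq_of_recursion_zero_one {A : Type*} [CommRing A] {z : A} {F G : ℤ → A}
    (hF : ∀ p, F (p + 2) = z * F (p + 1) + F p) (hG : ∀ p, G (p + 2) = z * G (p + 1) + G p)
    (h0 : F 0 = G 0) (h1 : F 1 = G 1) (p : ℤ) : F p = G p := by
  suffices H : F p = G p ∧ F (p + 1) = G (p + 1) from H.1
  induction p with
  | zero => exact ⟨h0, h1⟩
  | succ k ih =>
    refine ⟨ih.2, ?_⟩
    rw [show (k : ℤ) + 1 + 1 = k + 2 by ring, hF, hG, ih.1, ih.2]
  | pred k ih =>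
    have e1 := hF (-k - 1)
    have e2 := hG (-k - 1)
    rw [show -(k : ℤ) - 1 + 2 = -k + 1 by ring, show -(k : ℤ) - 1 + 1 = -k by ring] at e1 e2
    rw [show -(k : ℤ) - 1 + 1 = -k by ring]
    exact ⟨by linear_combination e2 - e1 + ih.2 - z * ih.1, ih.1⟩

/-- If `z` is invertible, a solution of the recursion is also determined by its values at `0`
and `-2`. -/
theorem eq_of_recursion {A : Type*} [CommRing A] {z z' : A} (hz : z' * z = 1) {F G : ℤ → A}
    (hF : ∀ p, F (p + 2) = z * F (p + 1) + F p) (hG : ∀ p, G (p + 2) = z * G (p + 1) + G p)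
    (h0 : F 0 = G 0) (h2 : F (-2) = G (-2)) (p : ℤ) : F p = G p := by
  refine eq_of_recursion_zero_one hF hG h0 ?_ p
  have e1 := hF (-2)
  have e2 := hG (-2)
  have e3 := hF (-1)
  have e4 := hG (-1)
  norm_num at e1 e2 e3 e4
  have h1 : F (-1) = G (-1) := by
    linear_combination (F (-1) - G (-1)) * (-hz) + z' * (e2 - e1 + h0 - h2)
  rw [e3, e4, h0, h1]

/-! ### The Conway polynomials of the torus links on two strands -/

theorem conway_skein (n : ℕ) (hn : 0 < n) (α β : BraidGroup n) (i : ℕ) (hi : i + 1 < n) :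
    conway (braidClosure hn (α * σ i hi * β)) =
      T 1 * conway (braidClosure hn (α * β)) +
        conway (braidClosure hn (α * (σ i hi)⁻¹ * β)) := by
  simp only [conway, homflypt_spec.skein n hn α β i hi, map_add, map_mul, map_pow, varV, varZ,
    eval₂_T, eval₂_C]
  simp

theorem torusConway_recursion (p : ℤ) :
    torusConway (p + 2) = T 1 * torusConway (p + 1) + torusConway p := by
  have h := conway_skein 2 two_pos ((σ 0 one_lt_two : BraidGroup 2) ^ (p + 1)) 1 0 one_lt_two
  simp only [mul_one, ← zpow_add_one, ← zpow_sub_one] at h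
  rw [show p + 1 + 1 = p + 2 by ring, show p + 1 - 1 = p by ring] at h
  exact h

theorem torusConway_one : torusConway 1 = 1 := by
  have h := Quot.sound (MarkovMove.stabPos 1 one_pos 1)
  have h' : braidClosure two_pos ((σ 0 one_lt_two : BraidGroup 2) ^ (1 : ℤ)) =
      braidClosure one_pos (1 : BraidGroup 1) := by
    rw [zpow_one]
    simp only [map_one, one_mul] at h
    exact h.symm
  rw [torusConway, h', conway, homflypt_spec.unknot, map_one]

theorem torusConway_neg_one : torusConway (-1) = 1 := by
  have h := Quot.sound (MarkovMove.stabNeg 1 one_pos 1)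
  have h' : braidClosure two_pos ((σ 0 one_lt_two : BraidGroup 2) ^ (-1 : ℤ)) =
      braidClosure one_pos (1 : BraidGroup 1) := by
    rw [zpow_neg_one]
    simp only [map_one, one_mul] at h
    exact h.symm
  rw [torusConway, h', conway, homflypt_spec.unknot, map_one]

theorem T_neg_one_mul_T_one {R : Type*} [CommSemiring R] : (T (-1) * T 1 : R[T;T⁻¹]) = 1 := by
  rw [← T_add]; simp

theorem torusConway_zero : torusConway 0 = 0 := by
  have h := torusConway_recursion (-1)
  norm_num only [torusConway_one, torusConway_neg_one] at h
  have h' := T_neg_one_mul_T_one (R := ℤ)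
  linear_combination (-T (-1) : ℤ[T;T⁻¹]) * h - torusConway 0 * h'

theorem torusConway_neg_three : torusConway (-3) = T 1 ^ 2 + 1 := by
  have h1 := torusConway_recursion (-2)
  have h2 := torusConway_recursion (-3)
  norm_num [torusConway_zero, torusConway_neg_one, -T_pow] at h1 h2
  linear_combination T 1 * h1 - h2

/-- Reflection of the index, with alternating signs, preserves the recursion. -/
theorem negOnePow_recursion {A : Type*} [CommRing A] {z : A} {F : ℤ → A}
    (hF : ∀ p, F (p + 2) = z * F (p + 1) + F p) (c p : ℤ) :
    ((p + 2).negOnePow : A) * F (c - (p + 2)) =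
      z * (((p + 1).negOnePow : A) * F (c - (p + 1))) + (p.negOnePow : A) * F (c - p) := by
  have h := hF (c - (p + 2))
  rw [show c - (p + 2) + 2 = c - p by ring, show c - (p + 2) + 1 = c - (p + 1) by ring] at h
  rw [show p + 2 = p + 1 + 1 by ring, Int.negOnePow_succ, Int.negOnePow_succ,
    show p + 1 + 1 = p + 2 by ring, h]
  push_cast
  ring

theorem torusConway_neg (p : ℤ) :
    torusConway (-p) = -((p.negOnePow : ℤ[T;T⁻¹]) * torusConway p) := by
  have h := eq_of_recursion_zero_one (z := T 1) (F := torusConway)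
    (G := fun p => -((p.negOnePow : ℤ[T;T⁻¹]) * torusConway (0 - p)))
    torusConway_recursion (fun p => by
      have := negOnePow_recursion torusConway_recursion 0 p
      simp only [this]; ring)
    (by simp [torusConway_zero]) (by simp [torusConway_one, torusConway_neg_one]) (-p)
  simpa [Int.negOnePow_neg] using h

/-- The polynomials `C_p` do not involve negative powers of `z`. -/
theorem exists_toLaurent_eq_torusConway (p : ℤ) :
    ∃ f : Polynomial ℤ, Polynomial.toLaurent f = torusConway p := by
  suffices H : (∃ f : Polynomial ℤ, Polynomial.toLaurent f = torusConway p) ∧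
      ∃ f : Polynomial ℤ, Polynomial.toLaurent f = torusConway (p + 1) from H.1
  induction p with
  | zero => exact ⟨⟨0, by simp [torusConway_zero]⟩, ⟨1, by simp [torusConway_one]⟩⟩
  | succ k ih =>
    obtain ⟨⟨f, hf⟩, ⟨g, hg⟩⟩ := ih
    refine ⟨⟨g, hg⟩, ⟨.X * g + f, ?_⟩⟩
    rw [show (k : ℤ) + 1 + 1 = k + 2 by ring, torusConway_recursion, map_add, map_mul, hf, hg,
      Polynomial.toLaurent_X]
  | pred k ih =>
    obtain ⟨⟨f, hf⟩, ⟨g, hg⟩⟩ := ih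
    have e := torusConway_recursion (-k - 1)
    rw [show -(k : ℤ) - 1 + 2 = -k + 1 by ring, show -(k : ℤ) - 1 + 1 = -k by ring] at e
    rw [show -(k : ℤ) - 1 + 1 = -k by ring]
    refine ⟨⟨g - .X * f, ?_⟩, ⟨f, hf⟩⟩
    rw [map_sub, map_mul, hf, hg, e, Polynomial.toLaurent_X]; ring

/-! ### The normalized Homflypt polynomial of a braid -/

/-- The Homflypt polynomial of the closure of a braid on `m + 1` strands, divided by `v ^ w`. It
factors through the Hecke algebra, and is a Markov trace up to normalization. -/
noncomputable def normHomflypt {m : ℕ} (β : BraidGroup (m + 1)) : LaurentVZ :=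
  T (-writhe β) * homflypt (braidClosure m.succ_pos β)

theorem isSkein_normHomflypt (m : ℕ) : IsSkein varZ (normHomflypt (m := m)) := by
  intro α β i h
  simp only [normHomflypt, homflypt_spec.skein, writhe_mul, writhe_inv, writhe_σ, varV]
  rw [show -(writhe α + 1 + writhe β) = -1 + -(writhe α + writhe β) by ring,
    show -(writhe α + -1 + writhe β) = 1 + -(writhe α + writhe β) by ring,
    T_add 1, T_add (-1)]
  have h1 := T_neg_one_mul_T_one (R := ℤ[T;T⁻¹])
  linear_combination (varZ * T (-(writhe α + writhe β)) *
    homflypt (braidClosure m.succ_pos (α * β)) + T 1 * T (-(writhe α + writhe β)) *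
    homflypt (braidClosure m.succ_pos (α * (σ i h)⁻¹ * β))) * h1

theorem normHomflypt_one : normHomflypt (1 : BraidGroup (0 + 1)) = 1 := by
  have h : homflypt (braidClosure (Nat.succ_pos 0) (1 : BraidGroup (0 + 1))) = 1 :=
    homflypt_spec.unknot
  rw [normHomflypt, h]
  simp [writhe]

theorem normHomflypt_incl_σ_incl {m : ℕ} (a b : BraidGroup (m + 1)) :
    normHomflypt (incl a * σ m (by omega) * incl b) = T (-1) * normHomflypt (a * b) := by
  have h1 : braidClosure (m + 1).succ_pos (incl a * σ m (by omega) * incl b) =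
      braidClosure (m + 1).succ_pos (incl (b * a) * σ m (by omega)) := by
    rw [map_mul, mul_assoc (incl b)]
    exact Quot.sound (MarkovMove.conj _ _ _ _)
  have h2 : braidClosure (m + 1).succ_pos (incl (b * a) * σ m (by omega)) =
      braidClosure m.succ_pos (b * a) :=
    (Quot.sound (MarkovMove.stabPos (m + 1) m.succ_pos (b * a))).symm
  have h3 : braidClosure m.succ_pos (b * a) = braidClosure m.succ_pos (a * b) :=
    Quot.sound (MarkovMove.conj _ _ _ _)
  simp only [normHomflypt, h1, h2, h3, writhe_mul, writhe_incl, writhe_σ]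
  rw [← mul_assoc, ← T_add]
  congr 2; ring

theorem normHomflypt_incl {m : ℕ} (a : BraidGroup (m + 1)) :
    normHomflypt (incl a) = C (T (-1)) * (T (-1) - T 1) * normHomflypt a := by
  have hs := isSkein_normHomflypt (m + 1) (incl a) 1 m (by omega)
  have hp := normHomflypt_incl_σ_incl a 1
  have hn : normHomflypt (incl a * (σ m (by omega))⁻¹) = T 1 * normHomflypt a := by
    have h : braidClosure (m + 1).succ_pos (incl a * (σ m (by omega))⁻¹) =
        braidClosure m.succ_pos a :=
      (Quot.sound (MarkovMove.stabNeg (m + 1) m.succ_pos a)).symm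
    simp only [normHomflypt, h, writhe_mul, writhe_incl, writhe_inv, writhe_σ]
    rw [← mul_assoc, ← T_add]
    congr 2; ring
  simp only [map_one, mul_one] at hs hp
  rw [hp, hn] at hs
  have hz : C (T (-1)) * varZ = 1 := by
    rw [varZ, ← map_mul, T_neg_one_mul_T_one, map_one]
  linear_combination -(C (T (-1)) : LaurentVZ) * hs - normHomflypt (incl a) * hz

/-- Induction on the number of strands: two families of functions with the skein relation agree if
they do so on one strand, and on the braids `a` and `a σ_m b`, with `a`, `b` on the first `m + 1`
strands. -/
theorem eq_of_isSkein {R ι : Type} [CommRing R] {z : R} {F G : ∀ m, ι → BraidGroup (m + 1) → R}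
    (hF : ∀ m c, IsSkein z (F m c)) (hG : ∀ m c, IsSkein z (G m c))
    (h0 : ∀ c, F 0 c 1 = G 0 c 1)
    (h1 : ∀ m, (∀ c β, F m c β = G m c β) → ∀ c a, F (m + 1) c (incl a) = G (m + 1) c (incl a))
    (h2 : ∀ m, (∀ c β, F m c β = G m c β) → ∀ c a b,
      F (m + 1) c (incl a * σ m (by omega) * incl b) =
        G (m + 1) c (incl a * σ m (by omega) * incl b))
    (m : ℕ) (c : ι) (β : BraidGroup (m + 1)) : F m c β = G m c β := by
  induction m generalizing c with
  | zero => rw [braid_one β, h0]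
  | succ m ih =>
    refine sub_eq_zero.1 (congrFun (IsSkein.eq_zero m ((hF (m + 1) c).sub (hG (m + 1) c))
      (fun a => ?_) (fun a b => ?_)) β)
    · exact sub_eq_zero.2 (h1 m ih c a)
    · exact sub_eq_zero.2 (h2 m ih c a b)

theorem coeff_T_mul {R : Type*} [CommSemiring R] (i k : ℤ) (f : R[T;T⁻¹]) :
    (T i * f).coeff k = f.coeff (k - i) := by
  rw [T, AddMonoidAlgebra.coeff_single_mul_apply, one_mul, neg_add_eq_sub]

theorem coeff_C_mul {R : Type*} [CommSemiring R] (r : R) (k : ℤ) (f : R[T;T⁻¹]) :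
    (C r * f).coeff k = r * f.coeff k := by
  rw [← smul_eq_C_mul, AddMonoidAlgebra.coeff_smul_apply, smul_eq_mul]

/-- On `m + 1` strands, only the powers `v ^ (2 * j - m)` with `0 ≤ j ≤ m` occur. -/
theorem coeff_normHomflypt_eq_zero (m : ℕ) (β : BraidGroup (m + 1)) (k : ℤ)
    (hk : ∀ j : ℕ, j ≤ m → k ≠ 2 * j - m) : (normHomflypt β).coeff k = 0 := by
  induction m generalizing k with
  | zero =>
    have := hk 0 le_rfl
    rw [braid_one β, normHomflypt_one, ← T_zero, T_apply, if_neg (by simpa using this.symm)]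
  | succ m ih =>
    have hm : ∀ j : ℕ, j ≤ m → k + 1 ≠ 2 * j - m := fun j hj h =>
      hk j (by omega) (by push_cast; omega)
    have hp : ∀ j : ℕ, j ≤ m → k - 1 ≠ 2 * j - m := fun j hj h =>
      hk (j + 1) (by omega) (by push_cast; omega)
    refine congrFun (IsSkein.eq_zero (z := (T 1 : ℤ[T;T⁻¹]))
      (φ := fun β => (normHomflypt β).coeff k) m (fun α β i h => ?_) (fun a => ?_)
      (fun a b => ?_)) β
    · simp only [isSkein_normHomflypt (m + 1) α β i h, varZ, AddMonoidAlgebra.coeff_add,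
        Finsupp.add_apply, coeff_C_mul]
    · simp only [normHomflypt_incl, mul_assoc, sub_mul, coeff_C_mul, AddMonoidAlgebra.coeff_sub,
        Finsupp.sub_apply, coeff_T_mul, sub_neg_eq_add, ih a _ hm, ih a _ hp, sub_self, mul_zero]
    · simp only [normHomflypt_incl_σ_incl, coeff_T_mul, sub_neg_eq_add, ih _ _ hm]

/-! ### The linear relations for the coefficients -/

/-- The `ℤ[z, z⁻¹]`-linear form on the Laurent polynomials in `v` that takes `v ^ k` to
`C_{k + c}`. -/
noncomputable def torusForm (c : ℤ) (f : LaurentVZ) : ℤ[T;T⁻¹] :=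
  Finsupp.linearCombination ℤ[T;T⁻¹] (fun k : ℤ => torusConway (k + c)) f.coeff

theorem torusForm_add (c : ℤ) (f g : LaurentVZ) :
    torusForm c (f + g) = torusForm c f + torusForm c g := by
  simp [torusForm]

theorem torusForm_sub (c : ℤ) (f g : LaurentVZ) :
    torusForm c (f - g) = torusForm c f - torusForm c g := by
  simp [torusForm]

theorem torusForm_C_mul (c : ℤ) (r : ℤ[T;T⁻¹]) (f : LaurentVZ) :
    torusForm c (C r * f) = r * torusForm c f := by
  simp [torusForm, ← smul_eq_C_mul]

theorem torusForm_T (c k : ℤ) : torusForm c (T k) = torusConway (k + c) := by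
  simp [torusForm, T, -single_eq_C_mul_T]

theorem torusForm_sum {ι : Type*} (s : Finset ι) (c : ℤ) (f : ι → LaurentVZ) :
    torusForm c (∑ i ∈ s, f i) = ∑ i ∈ s, torusForm c (f i) := by
  simp [torusForm]

theorem torusForm_T_mul (c i : ℤ) (f : LaurentVZ) :
    torusForm c (T i * f) = torusForm (i + c) f := by
  induction f using LaurentPolynomial.induction_on' with
  | add p q hp hq => rw [mul_add, torusForm_add, torusForm_add, hp, hq]
  | C_mul_T k r =>
    rw [mul_left_comm, torusForm_C_mul, torusForm_C_mul, ← T_add, torusForm_T, torusForm_T,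
      add_left_comm, add_assoc]

/-- All the linear relations at once. Both sides satisfy the skein relation in `β`. Adding a strand
multiplies the right-hand side by `-1`, which matches the factor `z⁻¹ (v⁻¹ - v)` on the left because
`C_{p+1} - C_{p-1} = z C_p`. -/
theorem torusForm_normHomflypt (m : ℕ) (c : ℤ) (β : BraidGroup (m + 1)) :
    torusForm c (normHomflypt β) =
      ((m + c + 1).negOnePow : ℤ[T;T⁻¹]) * torusConway (writhe β - c) := by
  refine eq_of_isSkein (z := (T 1 : ℤ[T;T⁻¹])) (ι := ℤ)
    (F := fun m c β => torusForm c (normHomflypt β))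
    (G := fun m c β => ((m + c + 1).negOnePow : ℤ[T;T⁻¹]) * torusConway (writhe β - c))
    (fun m c α β i h => ?_) (fun m c α β i h => ?_) (fun c => ?_) (fun m ih c a => ?_)
    (fun m ih c a b => ?_) m c β
  · simp only [isSkein_normHomflypt m α β i h, varZ, torusForm_add, torusForm_C_mul]
  · have e := torusConway_recursion (writhe α + writhe β - c - 1)
    simp only [writhe_mul, writhe_inv, writhe_σ]
    rw [show writhe α + 1 + writhe β - c = writhe α + writhe β - c - 1 + 2 by ring, e,
      show writhe α + writhe β - c - 1 + 1 = writhe α + writhe β - c by ring,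
      show writhe α + -1 + writhe β - c = writhe α + writhe β - c - 1 by ring]
    ring
  · rw [normHomflypt_one, ← T_zero, torusForm_T, show writhe (1 : BraidGroup (0 + 1)) = 0 by
      simp [writhe]]
    simp [torusConway_neg c, Int.negOnePow_succ, ← mul_assoc, ← mul_pow]
  · have e := torusConway_recursion (writhe a - c - 1)
    have hz := T_neg_one_mul_T_one (R := ℤ)
    have s0 : ((m + (-1 + c) + 1).negOnePow : ℤ[T;T⁻¹]) = ((m + c).negOnePow : ℤ[T;T⁻¹]) := by
      congr 3; ring
    have s1 : ((m + (1 + c) + 1).negOnePow : ℤ[T;T⁻¹]) = ((m + c).negOnePow : ℤ[T;T⁻¹]) := by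
      rw [show (m : ℤ) + (1 + c) + 1 = m + c + 1 + 1 by ring, Int.negOnePow_succ,
        Int.negOnePow_succ, neg_neg]
    have s2 : (((m + 1 : ℕ) + c + 1).negOnePow : ℤ[T;T⁻¹]) =
        ((m + c).negOnePow : ℤ[T;T⁻¹]) := by
      rw [← s1]; congr 3; push_cast; ring
    simp only [normHomflypt_incl, mul_assoc, sub_mul, torusForm_C_mul, torusForm_sub,
      torusForm_T_mul, ih, writhe_incl, s0, s1, s2]
    rw [show writhe a - (-1 + c) = writhe a - c - 1 + 2 by ring, e,
      show writhe a - c - 1 + 1 = writhe a - c by ring,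
      show writhe a - (1 + c) = writhe a - c - 1 by ring]
    linear_combination ((m + c).negOnePow : ℤ[T;T⁻¹]) * torusConway (writhe a - c) * hz
  · have s : (m : ℤ) + (-1 + c) + 1 = m + 1 + c + 1 - 2 := by ring
    simp only [normHomflypt_incl_σ_incl, torusForm_T_mul, ih, writhe_mul, writhe_incl, writhe_σ,
      Nat.cast_add, Nat.cast_one, s]
    rw [Int.negOnePow_sub, show Int.negOnePow 2 = 1 from rfl, mul_one]
    congr 2; ring

theorem laurentCoeff_eq_coeff {m : ℕ} (β : BraidGroup (m + 1)) (j : Fin (m + 1)) :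
    laurentCoeff m.succ_pos β j = (normHomflypt β).coeff (2 * (j : ℕ) - m) := by
  rw [laurentCoeff, normHomflypt, coeff_T_mul]
  congr 1; push_cast; ring

theorem normHomflypt_eq_sum {m : ℕ} (β : BraidGroup (m + 1)) :
    normHomflypt β =
      ∑ j : Fin (m + 1), C (laurentCoeff m.succ_pos β j) * T (2 * (j : ℕ) - m) := by
  ext1 k
  simp only [AddMonoidAlgebra.coeff_sum, Finsupp.finsetSum_apply, coeff_C_mul, T_apply,
    laurentCoeff_eq_coeff, mul_ite, mul_one, mul_zero]
  by_cases hk : ∃ j : Fin (m + 1), 2 * ((j : ℕ) : ℤ) - m = k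
  · obtain ⟨j, rfl⟩ := hk
    rw [Finset.sum_eq_single j, if_pos rfl]
    · intro i _ hi
      exact if_neg fun h => hi (Fin.ext (by omega))
    · simp
  · push Not at hk
    rw [coeff_normHomflypt_eq_zero m β k fun j hj h => hk ⟨j, by omega⟩ h.symm,
      Finset.sum_eq_zero fun j _ => if_neg (hk j)]

theorem homflypt_eq_sum {m : ℕ} (β : BraidGroup (m + 1)) :
    homflypt (braidClosure m.succ_pos β) = ∑ j : Fin (m + 1),
      C (laurentCoeff m.succ_pos β j) * T (writhe β - (m + 1 : ℕ) + 1 + 2 * (j : ℕ)) := by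
  have h : homflypt (braidClosure m.succ_pos β) = T (writhe β) * normHomflypt β := by
    rw [normHomflypt, ← mul_assoc, ← T_add]; simp
  rw [h, normHomflypt_eq_sum, Finset.mul_sum]
  refine Finset.sum_congr rfl fun j _ => ?_
  rw [mul_left_comm, ← T_add]
  congr 2; push_cast; ring

theorem sum_torusConway_mul_laurentCoeff {m : ℕ} (β : BraidGroup (m + 1)) (c : ℤ) :
    ∑ j : Fin (m + 1), torusConway (2 * (j : ℕ) - m + c) * laurentCoeff m.succ_pos β j =
      ((m + c + 1).negOnePow : ℤ[T;T⁻¹]) * torusConway (writhe β - c) := by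
  rw [← torusForm_normHomflypt, normHomflypt_eq_sum, torusForm_sum]
  refine Finset.sum_congr rfl fun j _ => ?_
  rw [torusForm_C_mul, torusForm_T, mul_comm]

theorem firstRelation_laurentCoeff {m : ℕ} (β : BraidGroup (m + 1)) :
    ∑ j : Fin (m + 1), torusConway (2 * (j : ℕ) - 3) * laurentCoeff m.succ_pos β j =
      torusConway (4 + writhe β - (m + 1 : ℕ)) := by
  have h := sum_torusConway_mul_laurentCoeff β (m - 3)
  rw [show (m : ℤ) + (m - 3) + 1 = 2 * (m - 1) by ring, Int.negOnePow_two_mul] at h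
  convert h using 3 with j
  · congr 1; ring
  · simp; congr 1; ring

theorem secondRelation_laurentCoeff {m : ℕ} (β : BraidGroup (m + 1)) :
    ∑ j : Fin (m + 1), torusConway (2 * (j : ℕ) - 1) * laurentCoeff m.succ_pos β j =
      torusConway (2 + writhe β - (m + 1 : ℕ)) := by
  have h := sum_torusConway_mul_laurentCoeff β (m - 1)
  rw [show (m : ℤ) + (m - 1) + 1 = 2 * m by ring, Int.negOnePow_two_mul] at h
  convert h using 3 with j
  · congr 1; ring
  · simp; congr 1; ring

/-! ### Independence -/

/-- The left-hand sides of the relations at a vector supported on the first two indices. -/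
theorem sum_torusConway_mul_cons_cons {m : ℕ} (r : ℤ) (a b : Polynomial ℤ) :
    ∑ j : Fin (m + 2), algebraMap ℤ[T;T⁻¹] ℤ[T;T⁻¹] (torusConway (2 * (j : ℕ) - r)) *
      Polynomial.toLaurent ((Fin.cons a (Fin.cons b 0) : Fin (m + 2) → Polynomial ℤ) j) =
    torusConway (-r) * Polynomial.toLaurent a + torusConway (2 - r) * Polynomial.toLaurent b := by
  rw [Fin.sum_univ_succ, Fin.sum_univ_succ]
  simp

theorem firstRelation_cons_cons {m : ℕ} (w : ℤ) (a b : Polynomial ℤ) :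
    FirstRelation w (fun j => Polynomial.toLaurent
      ((Fin.cons a (Fin.cons b 0) : Fin (m + 2) → Polynomial ℤ) j)) ↔
    (T 1 ^ 2 + 1) * Polynomial.toLaurent a + Polynomial.toLaurent b =
      torusConway (4 + w - (m + 2 : ℕ)) := by
  rw [FirstRelation, sum_torusConway_mul_cons_cons, torusConway_neg_three,
    show (2 : ℤ) - 3 = -1 by norm_num, torusConway_neg_one, one_mul, Algebra.algebraMap_self_apply]

theorem secondRelation_cons_cons {m : ℕ} (w : ℤ) (a b : Polynomial ℤ) :
    SecondRelation w (fun j => Polynomial.toLaurent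
      ((Fin.cons a (Fin.cons b 0) : Fin (m + 2) → Polynomial ℤ) j)) ↔
    Polynomial.toLaurent a + Polynomial.toLaurent b = torusConway (2 + w - (m + 2 : ℕ)) := by
  rw [SecondRelation, sum_torusConway_mul_cons_cons, torusConway_neg_one,
    show (2 : ℤ) - 1 = 1 by norm_num, torusConway_one, one_mul, one_mul,
    Algebra.algebraMap_self_apply]

theorem T_one_sq_ne_zero : (T 1 ^ 2 : ℤ[T;T⁻¹]) ≠ 0 :=
  ((isUnit_T 1).pow 2).ne_zero

/-- The solutions of the first relation on the first two indices are `(t, x - (z² + 1) t)`; as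
their sum `x - z² t` depends on `t`, one of `t = 0` and `t = 1` violates the second relation. -/
theorem exists_firstRelation_not_secondRelation (m : ℕ) (w : ℤ) :
    ∃ f : Fin (m + 2) → Polynomial ℤ, FirstRelation w (fun j => Polynomial.toLaurent (f j)) ∧
      ¬ SecondRelation w (fun j => Polynomial.toLaurent (f j)) := by
  obtain ⟨x, hx⟩ := exists_toLaurent_eq_torusConway (4 + w - (m + 2 : ℕ))
  by_contra! H
  have h0 := H (Fin.cons 0 (Fin.cons x 0))
  have h1 := H (Fin.cons 1 (Fin.cons (x - (.X ^ 2 + 1)) 0))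
  simp only [firstRelation_cons_cons, secondRelation_cons_cons, ← hx, map_sub, map_add, map_pow,
    map_one, map_zero, Polynomial.toLaurent_X] at h0 h1
  exact T_one_sq_ne_zero (by linear_combination h0 (by ring) - h1 (by ring))

/-- The solutions of the second relation on the first two indices are `(t, y - t)`, where the
left-hand side of the first relation has the value `y + z² t`. -/
theorem exists_secondRelation_not_firstRelation (m : ℕ) (w : ℤ) :
    ∃ f : Fin (m + 2) → Polynomial ℤ, SecondRelation w (fun j => Polynomial.toLaurent (f j)) ∧
      ¬ FirstRelation w (fun j => Polynomial.toLaurent (f j)) := by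
  obtain ⟨y, hy⟩ := exists_toLaurent_eq_torusConway (2 + w - (m + 2 : ℕ))
  by_contra! H
  have h0 := H (Fin.cons 0 (Fin.cons y 0))
  have h1 := H (Fin.cons 1 (Fin.cons (y - 1) 0))
  simp only [firstRelation_cons_cons, secondRelation_cons_cons, ← hy, map_sub,
    map_one, map_zero] at h0 h1
  exact T_one_sq_ne_zero (by linear_combination h1 (by ring) - h0 (by ring))

/-! ### The family of relations generated by the two -/

theorem sum_torusConway_mul_eq {n : ℕ} {A : Type*} [CommRing A] [Algebra ℤ[T;T⁻¹] A] {w : ℤ}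
    {f : Fin n → A} (h1 : FirstRelation w f) (h2 : SecondRelation w f) (κ : ℤ) :
    ∑ j : Fin n, algebraMap ℤ[T;T⁻¹] A (torusConway (2 * (j : ℕ) - 1 - κ)) * f j =
      algebraMap ℤ[T;T⁻¹] A (κ.negOnePow * torusConway (κ + 2 + w - n)) := by
  set φ := algebraMap ℤ[T;T⁻¹] A
  have hz : φ (T (-1)) * φ (T 1) = 1 := by rw [← map_mul, T_neg_one_mul_T_one, map_one]
  -- Both sides are solutions of the recursion as functions of `-κ`.
  have h := eq_of_recursion hz
    (F := fun p => ∑ j : Fin n, φ (torusConway (2 * (j : ℕ) - 1 + p)) * f j)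
    (G := fun p => φ (p.negOnePow * torusConway (2 + w - n - p)))
    (fun p => by
      rw [Finset.mul_sum, ← Finset.sum_add_distrib]
      refine Finset.sum_congr rfl fun j _ => ?_
      rw [← add_assoc, torusConway_recursion, map_add, map_mul, add_assoc _ p 1]
      ring)
    (fun p => by rw [negOnePow_recursion torusConway_recursion, map_add, map_mul])
    (by simpa [SecondRelation] using h2)
    (by
      rw [show Int.negOnePow (-2) = 1 from rfl, show 2 + w - n - -2 = 4 + w - (n : ℤ) by ring]
      simp only [Units.val_one, Int.cast_one, one_mul]
      rw [← h1]
      refine Finset.sum_congr rfl fun j _ => ?_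
      congr 3; ring)
    (-κ)
  simp only [Int.negOnePow_neg] at h
  rw [show κ + 2 + w - n = 2 + w - n - -κ by ring, ← h]
  simp only [sub_eq_add_neg]

end HomflyBraid

open HomflyBraid LaurentPolynomial in
theorem mainTheorem3 (n : ℕ) (hn : 0 < n) :
    -- the Laurent coefficients of every closed `n`-braid satisfy both relations
    (∀ β : BraidGroup n,
      homflypt (braidClosure hn β) =
          ∑ j : Fin n, C (laurentCoeff hn β j) * T (writhe β - n + 1 + 2 * (j : ℕ)) ∧
        ∑ j : Fin n, torusConway (2 * (j : ℕ) - 3) * laurentCoeff hn β j =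
          torusConway (4 + writhe β - n) ∧
        ∑ j : Fin n, torusConway (2 * (j : ℕ) - 1) * laurentCoeff hn β j =
          torusConway (2 + writhe β - n)) ∧
    -- the relations are independent, even over the ordinary polynomials, if `n > 1`
    (1 < n → ∀ w : ℤ,
      (∃ f : Fin n → Polynomial ℤ,
        FirstRelation w (fun j => Polynomial.toLaurent (f j)) ∧
          ¬ SecondRelation w (fun j => Polynomial.toLaurent (f j))) ∧
      (∃ f : Fin n → Polynomial ℤ,
        SecondRelation w (fun j => Polynomial.toLaurent (f j)) ∧
          ¬ FirstRelation w (fun j => Polynomial.toLaurent (f j)))) ∧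
    -- any solution of both relations solves the whole family
    (∀ (A : Type*) [CommRing A] [Algebra ℤ[T;T⁻¹] A] (w : ℤ) (f : Fin n → A),
      FirstRelation w f → SecondRelation w f → ∀ κ : ℤ,
        ∑ j : Fin n, algebraMap ℤ[T;T⁻¹] A (torusConway (2 * (j : ℕ) - 1 - κ)) * f j =
          algebraMap ℤ[T;T⁻¹] A (κ.negOnePow * torusConway (κ + 2 + w - n))) := by
  obtain ⟨m, rfl⟩ : ∃ m, n = m + 1 := ⟨n - 1, by omega⟩
  refine ⟨fun β => ⟨homflypt_eq_sum β, firstRelation_laurentCoeff β,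
    secondRelation_laurentCoeff β⟩, fun hm w => ?_,
    fun A _ _ w f h1 h2 κ => sum_torusConway_mul_eq h1 h2 κ⟩
  obtain ⟨k, rfl⟩ : ∃ k, m = k + 1 := ⟨m - 1, by omega⟩
  exact ⟨exists_firstRelation_not_secondRelation k w,
    exists_secondRelation_not_firstRelation k w⟩
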